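/- Let $n\ge 1$, let $(\mathbb M^n,g)$ be an $n$-dimensional complete (connected, smooth) Riemannian manifold with volume measure $d\upsilon_g$, write $|K|=\upsilon_g(K)$, and let $\Omega\subseteq\mathbb M^n$ be a nonempty bounded open set. For a compact set $K\subseteq\Omega$ put $$ \mathrm{cap}_p(K,\Omega)=\inf\Big\{\int_\Omega|\nabla f|^p\,d\upsilon_g:\ 1_K\le f\in C_0^1(\Omega)\Big\}\quad(0<p<\infty),\qquad \mathrm{cap}_\infty(K,\Omega)=\inf\Big\{\sup_{\Omega}|\nabla f|:\ 1_K\le f\in C_0^1(\Omega)\Big\}, $$ where $C^1_0(\Omega)$ is the set of $C^1$ functions with compact support in $\Omega$. Let $\nu_n$ be the volume of the unit ball of $\mathbb R^n$. All infima below are over the compact sets $K\subseteq\Omega$ with $|K|>0$. (i) If $1\le p<\infty$, $p\ne n$ and $\alpha<1-\frac pn$, then $\displaystyle\inf_K\,|K|^{-\alpha}\,\mathrm{cap}_p(K,\Omega)=0$. For $p=\infty$, $\displaystyle\inf_K\,|K|^{\frac1n}\,\mathrm{cap}_\infty(K,\Omega)=0$. (ii) If $p=n\ge 2$, then $$ \inf_K\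 |K|^{-1}\exp\Big(-\beta\,\mathrm{cap}_n(K,\Omega)^{\frac1{1-n}}\Big)=0\qquad\text{for every }\ \beta>n^{\frac n{n-1}}\nu_n^{\frac1{n-1}}, $$ with the conventions $0^{\frac1{1-n}}=+\infty$ and $e^{-\infty}=0$ (relevant only if $\mathrm{cap}_n(K,\Omega)=0$, e.g. if $\mathbb M^n$ is compact and $\Omega=\mathbb M^n$). -/

import Mathlib

open MeasureTheory Set Bundle
open scoped Manifold ContDiff ENNReal

noncomputable section

namespace RiemCap

section Topology

variable {n : ℕ} {M : Type*} [TopologicalSpace M]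

theorem measurableSet_chart [MeasurableSpace M] [BorelSpace M]
    (e : OpenPartialHomeomorph M (EuclideanSpace ℝ (Fin n)))
    {A : Set M} (hA : MeasurableSet A) : MeasurableSet (e.target ∩ e.symm ⁻¹' A) := by
  have h : Measurable (e.target.domRestrict e.symm) :=
    (e.continuousOn_symm.domRestrict).measurable
  have := (MeasurableEmbedding.subtype_coe e.open_target.measurableSet).measurableSet_image.2
    (h hA)
  convert this using 1
  ext y
  simp [Set.domRestrict, and_comm]

end Topology

section Volume

variable {n : ℕ} {M : Type*} [TopologicalSpace M] [ChartedSpace (EuclideanSpace ℝ (Fin n)) M]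
  [RiemannianBundle (fun x : M ↦ TangentSpace (𝓡 n) x)]

/-- The coefficients `g_ij(y) = g(∂ᵢ, ∂ⱼ)` of the Riemannian metric in the chart `e`, at the point
of `M` with coordinates `y`; here `∂ᵢ = d(e⁻¹)_y(bᵢ)` with `bᵢ` the standard basis of `ℝⁿ`. -/
def chartGram (e : OpenPartialHomeomorph M (EuclideanSpace ℝ (Fin n)))
    (y : EuclideanSpace ℝ (Fin n)) : Matrix (Fin n) (Fin n) ℝ :=
  Matrix.of fun i j ↦ inner ℝ
    (mfderiv (𝓡 n) (𝓡 n) e.symm y (EuclideanSpace.single i (1 : ℝ)))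
    (mfderiv (𝓡 n) (𝓡 n) e.symm y (EuclideanSpace.single j (1 : ℝ)))

/-- The measure `√det (g_ij) dy` of the chart domain `e.source`, extended by zero to `M`. -/
def chartVolume [MeasurableSpace M] (e : OpenPartialHomeomorph M (EuclideanSpace ℝ (Fin n))) :
    Measure M :=
  Measure.map e.symm ((volume.restrict e.target).withDensity
    fun y ↦ ENNReal.ofReal (Real.sqrt (chartGram e y).det))

variable (n M) in
/-- The Riemannian volume measure of `M`: the measure which in every smooth chart is
`√det (g_ij) dy`. The local measures `chartVolume e` agree on overlaps, and their supremum in the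
lattice of measures is the measure obtained by gluing them; see `riemannianVolume_apply`. -/
def riemannianVolume [MeasurableSpace M] : Measure M :=
  ⨆ e ∈ IsManifold.maximalAtlas (𝓡 n) ∞ M, chartVolume e

theorem chartVolume_apply [MeasurableSpace M] [BorelSpace M]
    (e : OpenPartialHomeomorph M (EuclideanSpace ℝ (Fin n)))
    {A : Set M} (hA : MeasurableSet A) :
    chartVolume e A = ∫⁻ y in e.target ∩ e.symm ⁻¹' A,
      ENNReal.ofReal (Real.sqrt (chartGram e y).det) := by
  have hm : AEMeasurable e.symm ((volume.restrict e.target).withDensity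
      fun y ↦ ENNReal.ofReal (Real.sqrt (chartGram e y).det)) :=
    (e.continuousOn_symm.aemeasurable e.open_target.measurableSet).mono_ac
      (withDensity_absolutelyContinuous _ _)
  have hS := measurableSet_chart e hA
  have hc : (volume.restrict e.target).withDensity
      (fun y ↦ ENNReal.ofReal (Real.sqrt (chartGram e y).det)) e.targetᶜ = 0 :=
    withDensity_absolutelyContinuous _ _ (by
      rw [Measure.restrict_apply e.open_target.measurableSet.compl]; simp)
  rw [chartVolume, Measure.map_apply_of_aemeasurable hm hA,
    ← measure_inter_conull hc, inter_comm, withDensity_apply _ hS,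
    Measure.restrict_restrict hS, inter_assoc, inter_comm _ e.target, ← inter_assoc, inter_self]

theorem gram_congr {x x' : M} (hx : x = x')
    {v : Fin n → TangentSpace (𝓡 n) x} {v' : Fin n → TangentSpace (𝓡 n) x'}
    (hv : ∀ i, (v i : EuclideanSpace ℝ (Fin n)) = v' i) : Matrix.gram ℝ v = Matrix.gram ℝ v' := by
  subst hx
  congr 1
  exact funext hv

/-- Change of coordinates for the Gram determinant of the metric. -/
theorem chartGram_det [IsManifold (𝓡 n) ∞ M]
    {e e' : OpenPartialHomeomorph M (EuclideanSpace ℝ (Fin n))}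
    (he : e ∈ IsManifold.maximalAtlas (𝓡 n) ∞ M) (he' : e' ∈ IsManifold.maximalAtlas (𝓡 n) ∞ M)
    {y : EuclideanSpace ℝ (Fin n)} (hy : y ∈ e'.target) (hy' : e'.symm y ∈ e.source) :
    DifferentiableAt ℝ (e ∘ e'.symm) y ∧
    (chartGram e' y).det = (fderiv ℝ (e ∘ e'.symm) y).det ^ 2 * (chartGram e (e (e'.symm y))).det := by
  have h1 : MDifferentiableAt (𝓡 n) (𝓡 n) e (e'.symm y) :=
    ((contMDiffOn_of_mem_maximalAtlas he).contMDiffAt (e.open_source.mem_nhds hy')).mdifferentiableAt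
      (by simp)
  have h2 : MDifferentiableAt (𝓡 n) (𝓡 n) e'.symm y :=
    ((contMDiffOn_symm_of_mem_maximalAtlas he').contMDiffAt
      (e'.open_target.mem_nhds hy)).mdifferentiableAt (by simp)
  have h3 : MDifferentiableAt (𝓡 n) (𝓡 n) e.symm ((e ∘ e'.symm) y) :=
    ((contMDiffOn_symm_of_mem_maximalAtlas he).contMDiffAt
      (e.open_target.mem_nhds (e.map_source hy'))).mdifferentiableAt (by simp)
  have h4 : MDifferentiableAt (𝓡 n) (𝓡 n) (e ∘ e'.symm) y := h1.comp y h2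
  have h5 : DifferentiableAt ℝ (e ∘ e'.symm) y := mdifferentiableAt_iff_differentiableAt.1 h4
  refine ⟨h5, ?_⟩
  have hev : e.symm ∘ (e ∘ e'.symm) =ᶠ[nhds y] e'.symm := by
    filter_upwards [e'.open_target.mem_nhds hy,
      (e'.continuousAt_symm hy).preimage_mem_nhds (e.open_source.mem_nhds hy')] with z hz hz'
    simp [e.left_inv hz']
  set J := fderiv ℝ (e ∘ e'.symm) y with hJ
  have hL : (mfderiv (𝓡 n) (𝓡 n) e'.symm y : EuclideanSpace ℝ (Fin n) →L[ℝ] EuclideanSpace ℝ (Fin n))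
      = (mfderiv (𝓡 n) (𝓡 n) e.symm (e (e'.symm y)) :
          EuclideanSpace ℝ (Fin n) →L[ℝ] EuclideanSpace ℝ (Fin n)) ∘L J := by
    have := mfderiv_comp y h3 h4
    rw [mfderiv_eq_fderiv] at this
    exact (hev.mfderiv_eq).symm.trans this
  have hx : e'.symm y = e.symm (e (e'.symm y)) := (e.left_inv hy').symm
  set x := e.symm (e (e'.symm y))
  let L : EuclideanSpace ℝ (Fin n) →L[ℝ] TangentSpace (𝓡 n) x :=
    mfderiv (𝓡 n) (𝓡 n) e.symm (e (e'.symm y))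
  have h6 : chartGram e' y = Matrix.gram ℝ fun i ↦ L (J (EuclideanSpace.single i 1)) :=
    gram_congr hx fun i ↦ DFunLike.congr_fun hL _
  let Jm : Matrix (Fin n) (Fin n) ℝ := Matrix.of fun k i ↦ J (EuclideanSpace.single i 1) k
  have h7 : chartGram e' y = Jm.transpose * chartGram e (e (e'.symm y)) * Jm := by
    rw [h6]
    have hdec : ∀ i, L (J (EuclideanSpace.single i 1)) =
        ∑ k, Jm k i • L (EuclideanSpace.single k 1) := by
      intro i
      have : J (EuclideanSpace.single i 1) = ∑ k, Jm k i • EuclideanSpace.single k (1 : ℝ) := by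
        ext l
        simp [Jm, Finset.sum_apply, Pi.single_apply]
      conv_lhs => rw [this]
      simp only [map_sum, map_smul]
    ext i j
    rw [Matrix.gram_apply, hdec, hdec, sum_inner, Matrix.mul_assoc, Matrix.mul_apply]
    refine Finset.sum_congr rfl fun k _ ↦ ?_
    rw [inner_sum, Matrix.mul_apply, Finset.mul_sum]
    refine Finset.sum_congr rfl fun l _ ↦ ?_
    rw [real_inner_smul_left, real_inner_smul_right, Matrix.transpose_apply, mul_comm (chartGram _ _ _ _)]
    rfl
  have hdet : Jm.det = J.det := by
    have : Jm = LinearMap.toMatrix (EuclideanSpace.basisFun (Fin n) ℝ).toBasis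
        (EuclideanSpace.basisFun (Fin n) ℝ).toBasis (J : _ →ₗ[ℝ] _) := by
      ext i j
      simp [Jm, LinearMap.toMatrix_apply]
    rw [this, LinearMap.det_toMatrix]
  rw [h7, Matrix.det_mul, Matrix.det_mul, Matrix.det_transpose, hdet]
  ring

theorem chartVolume_le [MeasurableSpace M] [BorelSpace M] [IsManifold (𝓡 n) ∞ M]
    {e e' : OpenPartialHomeomorph M (EuclideanSpace ℝ (Fin n))}
    (he : e ∈ IsManifold.maximalAtlas (𝓡 n) ∞ M) (he' : e' ∈ IsManifold.maximalAtlas (𝓡 n) ∞ M)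
    {A : Set M} (hA : MeasurableSet A) (hAe : A ⊆ e.source) :
    chartVolume e' A ≤ chartVolume e A := by
  rw [chartVolume_apply e' hA, chartVolume_apply e hA]
  set S := e'.target ∩ e'.symm ⁻¹' A
  have hS : MeasurableSet S := measurableSet_chart e' hA
  have key := lintegral_image_eq_lintegral_abs_det_fderiv_mul volume hS
    (f := e ∘ e'.symm) (f' := fun y ↦ fderiv ℝ (e ∘ e'.symm) y)
    (fun y hy ↦ (chartGram_det he he' hy.1 (hAe hy.2)).1.hasFDerivAt.hasFDerivWithinAt)
    (fun y hy z hz h ↦ e'.symm.injOn hy.1 hz.1 (e.injOn (hAe hy.2) (hAe hz.2) h))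
    (fun y ↦ ENNReal.ofReal (Real.sqrt (chartGram e y).det))
  have hsub : (e ∘ e'.symm) '' S ⊆ e.target ∩ e.symm ⁻¹' A := by
    rintro _ ⟨y, hy, rfl⟩
    refine ⟨e.map_source (hAe hy.2), ?_⟩
    simpa [e.left_inv (hAe hy.2)] using hy.2
  refine le_trans (le_of_eq ?_) (lintegral_mono_set hsub)
  rw [key]
  refine setLIntegral_congr_fun hS fun y hy ↦ ?_
  rw [(chartGram_det he he' hy.1 (hAe hy.2)).2, Real.sqrt_mul (sq_nonneg _), Real.sqrt_sq_eq_abs,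
    ENNReal.ofReal_mul (abs_nonneg _)]
  rfl

/-- The Riemannian volume has the density `√det (g_ij)` in every smooth chart `e`. -/
theorem riemannianVolume_apply [MeasurableSpace M] [BorelSpace M] [IsManifold (𝓡 n) ∞ M]
    {e : OpenPartialHomeomorph M (EuclideanSpace ℝ (Fin n))}
    (he : e ∈ IsManifold.maximalAtlas (𝓡 n) ∞ M)
    {A : Set M} (hA : MeasurableSet A) (hAe : A ⊆ e.source) :
    riemannianVolume n M A = ∫⁻ y in e.target ∩ e.symm ⁻¹' A,
      ENNReal.ofReal (Real.sqrt (chartGram e y).det) := by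
  rw [← chartVolume_apply e hA]
  refine le_antisymm ?_ ((le_iSup₂ (f := fun e _ ↦ chartVolume e) e he :
    chartVolume e ≤ riemannianVolume n M) A)
  let ν : Measure M := (chartVolume e).restrict e.source + (⊤ : ℝ≥0∞) • Measure.count.restrict e.sourceᶜ
  have hν : riemannianVolume n M ≤ ν := by
    refine iSup₂_le fun e' he' ↦ Measure.le_iff.2 fun B hB ↦ ?_
    rw [← measure_inter_add_sdiff B e.open_source.measurableSet]
    rw [Measure.add_apply, Measure.restrict_apply hB]
    refine add_le_add (chartVolume_le he he' (hB.inter e.open_source.measurableSet)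
      inter_subset_right) ?_
    rw [Measure.smul_apply, Measure.restrict_apply hB]
    rcases eq_empty_or_nonempty (B \ e.source) with h | h
    · simp [h]
    · have h0 : Measure.count (B ∩ e.sourceᶜ) ≠ 0 := Measure.count_ne_zero h
      rw [smul_eq_mul, ENNReal.top_mul h0]
      exact le_top
  refine (hν A).trans (le_of_eq ?_)
  have h0 : A ∩ e.sourceᶜ = ∅ := by
    rw [← sdiff_eq]; exact sdiff_eq_empty.2 hAe
  rw [Measure.add_apply, Measure.smul_apply, Measure.restrict_apply hA, Measure.restrict_apply hA,
    inter_eq_self_of_subset_left hAe, h0]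
  simp

end Volume

section Capacity

variable {n : ℕ} {M : Type*} [TopologicalSpace M] [ChartedSpace (EuclideanSpace ℝ (Fin n)) M]
  [RiemannianBundle (fun x : M ↦ TangentSpace (𝓡 n) x)]

variable (n) in
/-- The Riemannian gradient `∇f(x) ∈ T_xM`, the vector with `⟪∇f(x), v⟫ = df_x(v)` for all `v`. -/
def gradient (f : M → ℝ) (x : M) : TangentSpace (𝓡 n) x :=
  haveI : FiniteDimensional ℝ (TangentSpace (𝓡 n) x) :=
    inferInstanceAs (FiniteDimensional ℝ (EuclideanSpace ℝ (Fin n)))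
  haveI : CompleteSpace (TangentSpace (𝓡 n) x) := FiniteDimensional.complete ℝ _
  (InnerProductSpace.toDual ℝ (TangentSpace (𝓡 n) x)).symm (mfderiv (𝓡 n) 𝓘(ℝ, ℝ) f x)

theorem inner_gradient (f : M → ℝ) (x : M) (v : TangentSpace (𝓡 n) x) :
    inner ℝ (gradient n f x) v = mfderiv (𝓡 n) 𝓘(ℝ, ℝ) f x v := by
  have : FiniteDimensional ℝ (TangentSpace (𝓡 n) x) :=
    inferInstanceAs (FiniteDimensional ℝ (EuclideanSpace ℝ (Fin n)))
  have : CompleteSpace (TangentSpace (𝓡 n) x) := FiniteDimensional.complete ℝ _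
  exact InnerProductSpace.toDual_symm_apply

variable (n) in
/-- The admissible functions of the condenser `(K, Ω)`: the `f ∈ C₀¹(Ω)` (class `C¹`, with compact
support contained in `Ω`) with `1_K ≤ f`. -/
def admissible (K Ω : Set M) : Set (M → ℝ) :=
  {f | ContMDiff (𝓡 n) 𝓘(ℝ, ℝ) 1 f ∧ HasCompactSupport f ∧ tsupport f ⊆ Ω ∧
    ∀ x, K.indicator (fun _ ↦ (1 : ℝ)) x ≤ f x}

variable (n) in
/-- The relative `p`-capacity of `(K, Ω)`, `0 < p ≤ ∞`. For `p < ∞` it is the infimum of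
`∫_Ω |∇f|^p dυ_g`, and for `p = ∞` that of `sup_Ω |∇f|`, over all admissible `f`. -/
def relCap [MeasurableSpace M] (p : ℝ≥0∞) (K Ω : Set M) : ℝ≥0∞ :=
  if p = ⊤ then ⨅ f ∈ admissible n K Ω, ⨆ x ∈ Ω, ‖gradient n f x‖ₑ
  else ⨅ f ∈ admissible n K Ω, ∫⁻ x in Ω, ‖gradient n f x‖ₑ ^ p.toReal ∂(riemannianVolume n M)

variable (n) in
/-- The compact subsets of `Ω` of positive volume. -/
def compactSubsets [MeasurableSpace M] (Ω : Set M) : Set (Set M) :=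
  {K | IsCompact K ∧ K ⊆ Ω ∧ 0 < riemannianVolume n M K}

/-- The volume `ν_n` of the open unit ball of `ℝⁿ`. -/
def unitBallVolume (n : ℕ) : ℝ := volume.real (Metric.ball (0 : EuclideanSpace ℝ (Fin n)) 1)

end Capacity

end RiemCap

end

/-!
All three infima vanish already along the images `K_r` of small concentric coordinate balls, so the
statement is local; completeness of the manifold and boundedness of `Ω` play no role.

Around a point of `Ω` choose a chart centred there in which `g_ij` equals `δ_ij` at the centre
(`exists_chart_chartGram_eq_one`). By continuity of the metric coefficients the metric is Euclidean
up to any prescribed factor `l > 1` on a small ball of radius `R` (`exists_almostEuclideanOn`).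
Hence `|K_r|` is comparable to `ν_n r ^ n`, and a test function `ψ` on `ℝⁿ` transplanted to the
manifold bounds the capacity of `K_r` by its Euclidean energy times a power of `l`
(`relCap_image_symm_le`).

* For finite `p` a bump function at scale `r` gives `cap_p (K_r) ≤ C r ^ (n - p)`
  (`exists_relCap_ball_le`), so `|K_r| ^ (-α) cap_p (K_r) ≤ C r ^ (n - p - n α)`, with positive
  exponent.
* For `p = ∞` one fixed bump function is admissible for all small `K_r`, so `cap_∞ (K_r)` stays
  bounded while `|K_r|` tends to `0`.
* For `p = n` a `C¹` approximation of the logarithmic potential (`exists_log_cutoff`) gives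
  `cap_n (K_r) ≤ l ^ (2 n + 1) n ν_n (log (R / r)) ^ (1 - n)` (`relCap_conformal_ball_le`), so the
  exponential is at most `(r / R) ^ γ` with `γ = β (l ^ (2 n + 1) n ν_n) ^ (1 / (1 - n))`. As `l`
  tends to `1`, the condition `γ > n` becomes exactly the hypothesis on `β` (`exists_distortion`),
  and `r ^ γ` beats `|K_r|⁻¹ ≤ C r ^ (-n)`.
-/

namespace RiemCap

/-! ### Charts that are Euclidean at a point -/

section Charts

variable {n : ℕ} {M : Type*} [TopologicalSpace M] [ChartedSpace (EuclideanSpace ℝ (Fin n)) M]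

/-- Composing a smooth chart with a diffeomorphism of `ℝⁿ` gives a smooth chart. -/
theorem transHomeomorph_mem_maximalAtlas [IsManifold (𝓡 n) ∞ M]
    {c : OpenPartialHomeomorph M (EuclideanSpace ℝ (Fin n))}
    (hc : c ∈ IsManifold.maximalAtlas (𝓡 n) ∞ M)
    (h : EuclideanSpace ℝ (Fin n) ≃ₜ EuclideanSpace ℝ (Fin n))
    (h1 : ContDiff ℝ ∞ h) (h2 : ContDiff ℝ ∞ h.symm) :
    c.transHomeomorph h ∈ IsManifold.maximalAtlas (𝓡 n) ∞ M := by
  refine OpenPartialHomeomorph.mem_maximalAtlas_of_contMDiffOn _ ?_ ?_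
  · exact h1.contMDiff.comp_contMDiffOn (contMDiffOn_of_mem_maximalAtlas hc)
  · exact (contMDiffOn_symm_of_mem_maximalAtlas hc).comp h2.contMDiff.contMDiffOn
      (fun y hy ↦ hy)

variable [RiemannianBundle (fun x : M ↦ TangentSpace (𝓡 n) x)]

/-- Around every point there is a smooth chart, centred at the point, in which the coefficients
`g_ij` of the metric at the centre are those of the Euclidean metric. -/
theorem exists_chart_chartGram_eq_one [IsManifold (𝓡 n) ∞ M] (o : M) :
    ∃ e ∈ IsManifold.maximalAtlas (𝓡 n) ∞ M, o ∈ e.source ∧ e o = 0 ∧ chartGram e 0 = 1 := by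
  let c := chartAt (EuclideanSpace ℝ (Fin n)) o
  have hc : c ∈ IsManifold.maximalAtlas (𝓡 n) ∞ M := IsManifold.chart_mem_maximalAtlas o
  have ho : o ∈ c.source := mem_chart_source _ o
  have hcd : c.MDifferentiable (𝓡 n) (𝓡 n) :=
    have : IsManifold (𝓡 n) 1 M := IsManifold.of_le (n := ∞) (by simp)
    mdifferentiable_chart o
  have : FiniteDimensional ℝ (TangentSpace (𝓡 n) o) :=
    inferInstanceAs (FiniteDimensional ℝ (EuclideanSpace ℝ (Fin n)))
  have hfr : Module.finrank ℝ (TangentSpace (𝓡 n) o) = n :=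
    (finrank_euclideanSpace_fin : Module.finrank ℝ (EuclideanSpace ℝ (Fin n)) = n)
  let b : OrthonormalBasis (Fin n) ℝ (TangentSpace (𝓡 n) o) :=
    (stdOrthonormalBasis ℝ _).reindex (finCongr hfr)
  -- the coordinates of `d c_o (v)` in terms of the orthonormal coordinates of `v`
  let B : EuclideanSpace ℝ (Fin n) ≃L[ℝ] EuclideanSpace ℝ (Fin n) :=
    (b.repr.symm.toLinearEquiv.trans
      (hcd.mfderiv ho).toLinearEquiv).toContinuousLinearEquiv
  let h : EuclideanSpace ℝ (Fin n) ≃ₜ EuclideanSpace ℝ (Fin n) :=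
    (B.toHomeomorph.trans (Homeomorph.addRight (c o))).symm
  have h1 : ContDiff ℝ ∞ h := B.symm.contDiff.comp (contDiff_id.add contDiff_const)
  have hsymm : ∀ y, h.symm y = B y + c o := fun y ↦ rfl
  have hsymm0 : h.symm 0 = c o := by rw [hsymm, map_zero, zero_add]
  have h2 : ContDiff ℝ ∞ h.symm := by
    have : (h.symm : _ → _) = fun y ↦ B y + c o := funext hsymm
    rw [this]
    exact B.contDiff.add contDiff_const
  refine ⟨c.transHomeomorph h, transHomeomorph_mem_maximalAtlas hc h h1 h2, ho, ?_, ?_⟩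
  · exact h.symm.injective (by simp [hsymm0])
  · have hx : (c.transHomeomorph h).symm 0 = o := by
      change c.symm (h.symm 0) = o
      rw [hsymm0, c.left_inv ho]
    have hd : ∀ w : EuclideanSpace ℝ (Fin n),
        (mfderiv (𝓡 n) (𝓡 n) (c.transHomeomorph h).symm 0 w : EuclideanSpace ℝ (Fin n)) =
          mfderiv (𝓡 n) (𝓡 n) c.symm (h.symm 0) (B w) := by
      intro w
      have hfd : HasFDerivAt h.symm (B : EuclideanSpace ℝ (Fin n) →L[ℝ] _) 0 := by
        have : (h.symm : _ → _) = fun y ↦ B y + c o := funext hsymm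
        rw [this]
        exact B.hasFDerivAt.add_const _
      have h3 : MDifferentiableAt (𝓡 n) (𝓡 n) c.symm (h.symm 0) :=
        hcd.mdifferentiableAt_symm (by rw [hsymm0]; exact c.map_source ho)
      have := HasMFDerivAt.comp (0 : EuclideanSpace ℝ (Fin n)) h3.hasMFDerivAt
        hfd.hasMFDerivAt
      exact DFunLike.congr_fun this.mfderiv w
    have hz : ∀ z, z = c o → ∀ w : EuclideanSpace ℝ (Fin n),
        (mfderiv (𝓡 n) (𝓡 n) c.symm z w : EuclideanSpace ℝ (Fin n)) =
          (hcd.mfderiv ho).symm w := by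
      rintro _ rfl w
      rfl
    have hv : ∀ i, (mfderiv (𝓡 n) (𝓡 n) (c.transHomeomorph h).symm 0
        (EuclideanSpace.single i (1 : ℝ)) : EuclideanSpace ℝ (Fin n)) = b i := by
      intro i
      rw [hd, hz _ hsymm0, ← b.repr_symm_single]
      exact (hcd.mfderiv ho).symm_apply_apply _
    refine (gram_congr hx hv).trans ?_
    ext i j
    rw [Matrix.gram_apply, Matrix.one_apply]
    exact orthonormal_iff_ite.1 b.orthonormal i j

/-- The coefficients `g_ij` of the metric in a smooth chart are continuous. -/
theorem continuousOn_chartGram [IsManifold (𝓡 n) ∞ M]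
    [IsContMDiffRiemannianBundle (𝓡 n) ∞ (EuclideanSpace ℝ (Fin n))
      (fun x : M ↦ TangentSpace (𝓡 n) x)]
    {e : OpenPartialHomeomorph M (EuclideanSpace ℝ (Fin n))}
    (he : e ∈ IsManifold.maximalAtlas (𝓡 n) ∞ M) :
    ContinuousOn (chartGram e) e.target := by
  have : IsManifold (𝓡 n) 1 M := IsManifold.of_le (n := ∞) (by simp)
  have hs : ContMDiffOn (𝓡 n) (𝓡 n) ∞ e.symm e.target := contMDiffOn_symm_of_mem_maximalAtlas he
  have hu : UniqueMDiffOn (𝓡 n) e.target := e.open_target.uniqueMDiffOn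
  have ht := hs.continuousOn_tangentMapWithin (by simp) hu
  have hv : ∀ i, ContinuousOn (fun y ↦ (⟨e.symm y,
      mfderiv (𝓡 n) (𝓡 n) e.symm y (EuclideanSpace.single i (1 : ℝ))⟩ :
        TotalSpace (EuclideanSpace ℝ (Fin n)) fun x : M ↦ TangentSpace (𝓡 n) x)) e.target := by
    intro i
    have hc : ContinuousOn (fun y ↦ (⟨y, EuclideanSpace.single i (1 : ℝ)⟩ :
        TangentBundle (𝓡 n) (EuclideanSpace ℝ (Fin n)))) e.target := by
      have h := (tangentBundleModelSpaceHomeomorph (𝓡 n)).symm.continuous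
      exact (h.comp (continuous_id.prodMk continuous_const)).continuousOn
    refine (ht.comp hc (fun y hy ↦ hy)).congr fun y hy ↦ ?_
    simp only [Function.comp, tangentMapWithin]
    rw [mfderivWithin_of_isOpen e.open_target hy]
  have : IsContMDiffRiemannianBundle (𝓡 n) 0 (EuclideanSpace ℝ (Fin n))
      (fun x : M ↦ TangentSpace (𝓡 n) x) := IsContMDiffRiemannianBundle.of_le (n := ∞) (by simp)
  have : IsContinuousRiemannianBundle (EuclideanSpace ℝ (Fin n))
      (fun x : M ↦ TangentSpace (𝓡 n) x) := by
    obtain ⟨g, hg, hg'⟩ := this.exists_contMDiff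
    exact ⟨g, hg.continuous, hg'⟩
  refine continuousOn_pi.2 fun i ↦ continuousOn_pi.2 fun j ↦ ?_
  exact (hv i).inner_bundle (hv j)

end Charts

/-! ### Almost Euclidean charts -/

section AlmostEuclidean

variable {n : ℕ} {M : Type*} [TopologicalSpace M] [ChartedSpace (EuclideanSpace ℝ (Fin n)) M]
  [RiemannianBundle (fun x : M ↦ TangentSpace (𝓡 n) x)]

/-- The squared length of a coordinate vector `w` at `y`, in terms of the coefficients `g_ij`. -/
theorem norm_sq_mfderiv_symm (e : OpenPartialHomeomorph M (EuclideanSpace ℝ (Fin n)))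
    (y w : EuclideanSpace ℝ (Fin n)) :
    ‖mfderiv (𝓡 n) (𝓡 n) e.symm y w‖ ^ 2 = ∑ i, ∑ j, w i * w j * chartGram e y i j := by
  let L : EuclideanSpace ℝ (Fin n) →L[ℝ] TangentSpace (𝓡 n) (e.symm y) :=
    mfderiv (𝓡 n) (𝓡 n) e.symm y
  have hw : w = ∑ i, w i • EuclideanSpace.single i (1 : ℝ) := by
    ext l
    simp [Finset.sum_apply, Pi.single_apply]
  have hL : L w = ∑ i, w i • L (EuclideanSpace.single i (1 : ℝ)) := by
    conv_lhs => rw [hw]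
    simp only [map_sum, map_smul]
  change ‖L w‖ ^ 2 = _
  rw [← real_inner_self_eq_norm_sq, hL, sum_inner]
  refine Finset.sum_congr rfl fun i _ ↦ ?_
  rw [inner_sum]
  refine Finset.sum_congr rfl fun j _ ↦ ?_
  rw [real_inner_smul_left, real_inner_smul_right, mul_assoc]
  rfl

/-- The metric, read in the chart `e`, agrees with the Euclidean metric on `B` up to the factor
`l`. Only the estimates used for upper bounds of capacities are required: `g` is bounded below,
and its volume density is bounded above and below. -/
structure AlmostEuclideanOn (e : OpenPartialHomeomorph M (EuclideanSpace ℝ (Fin n))) (l : ℝ)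
    (B : Set (EuclideanSpace ℝ (Fin n))) : Prop where
  mem_maximalAtlas : e ∈ IsManifold.maximalAtlas (𝓡 n) ∞ M
  subset_target : B ⊆ e.target
  norm_le : ∀ y ∈ B, ∀ w : EuclideanSpace ℝ (Fin n),
    ‖w‖ ≤ l * ‖mfderiv (𝓡 n) (𝓡 n) e.symm y w‖
  le_sqrt_det : ∀ y ∈ B, l⁻¹ ≤ √(chartGram e y).det
  sqrt_det_le : ∀ y ∈ B, √(chartGram e y).det ≤ l

/-- Every nonempty open set contains a coordinate ball on which the metric is Euclidean up to any
prescribed factor `l > 1`. -/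
theorem exists_almostEuclideanOn [IsManifold (𝓡 n) ∞ M]
    [IsContMDiffRiemannianBundle (𝓡 n) ∞ (EuclideanSpace ℝ (Fin n))
      (fun x : M ↦ TangentSpace (𝓡 n) x)]
    {Ω : Set M} (hΩ : IsOpen Ω) (hΩne : Ω.Nonempty) {l : ℝ} (hl : 1 < l) :
    ∃ (e : OpenPartialHomeomorph M (EuclideanSpace ℝ (Fin n))) (R : ℝ), 0 < R ∧
      AlmostEuclideanOn e l (Metric.closedBall 0 R) ∧ e.symm '' Metric.closedBall 0 R ⊆ Ω := by
  obtain ⟨o, ho⟩ := hΩne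
  obtain ⟨e, he, hoe, he0, hG⟩ :=
    exists_chart_chartGram_eq_one (n := n) o
  have h0 : (0 : EuclideanSpace ℝ (Fin n)) ∈ e.target := he0 ▸ e.map_source hoe
  have hcont : ContinuousAt (chartGram e) 0 :=
    (continuousOn_chartGram he).continuousAt (e.open_target.mem_nhds h0)
  have hdet : Filter.Tendsto (fun y ↦ √(chartGram e y).det) (nhds 0) (nhds 1) := by
    have : ContinuousAt (fun y ↦ √(chartGram e y).det) 0 :=
      (Continuous.matrix_det continuous_id).continuousAt.comp hcont |>.sqrt
    simpa [ContinuousAt, hG] using this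
  have hent : Filter.Tendsto
      (fun y ↦ ∑ i, ∑ j, |chartGram e y i j - (1 : Matrix (Fin n) (Fin n) ℝ) i j|)
      (nhds 0) (nhds 0) := by
    have : ContinuousAt
      (fun y ↦ ∑ i, ∑ j, |chartGram e y i j - (1 : Matrix (Fin n) (Fin n) ℝ) i j|) 0 := by
      refine tendsto_finsetSum _ fun i _ ↦ tendsto_finsetSum _ fun j _ ↦ ?_
      have hij : Continuous fun A : Matrix (Fin n) (Fin n) ℝ ↦ A i j :=
        continuous_id.matrix_elem i j
      exact ((hij.continuousAt.comp hcont).sub continuousAt_const).abs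
    simpa [ContinuousAt, hG] using this
  have hl2 : (0 : ℝ) < 1 - (l ^ 2)⁻¹ := sub_pos.2 (inv_lt_one_of_one_lt₀ (by nlinarith))
  have hΩ0 : ∀ᶠ y in nhds (0 : EuclideanSpace ℝ (Fin n)), e.symm y ∈ Ω := by
    refine (e.continuousAt_symm h0).preimage_mem_nhds (hΩ.mem_nhds ?_)
    rwa [← he0, e.left_inv hoe]
  have hmem : ∀ᶠ y in nhds (0 : EuclideanSpace ℝ (Fin n)), y ∈ e.target :=
    e.open_target.mem_nhds h0
  have hall := hmem.and <| hΩ0.and <|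
    (hent.eventually_lt_const hl2).and <|
    (hdet.eventually_const_lt (inv_lt_one_of_one_lt₀ hl)).and (hdet.eventually_lt_const hl)
  obtain ⟨R, hR, hball⟩ := Metric.nhds_basis_closedBall.eventually_iff.1 hall
  refine ⟨e, R, hR, ⟨he, fun y hy ↦ (hball hy).1, fun y hy w ↦ ?_, fun y hy ↦
    (hball hy).2.2.2.1.le, fun y hy ↦ (hball hy).2.2.2.2.le⟩, ?_⟩
  · have hsum := (hball hy).2.2.1
    have hw : ‖w‖ ^ 2 = ∑ i, ∑ j, w i * w j * (1 : Matrix (Fin n) (Fin n) ℝ) i j := by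
      rw [EuclideanSpace.real_norm_sq_eq]
      simp [Matrix.one_apply, sq]
    have hdiff : ‖w‖ ^ 2 - ‖mfderiv (𝓡 n) (𝓡 n) e.symm y w‖ ^ 2 ≤
        (1 - (l ^ 2)⁻¹) * ‖w‖ ^ 2 := by
      rw [norm_sq_mfderiv_symm]
      nth_rewrite 1 [hw]
      rw [← Finset.sum_sub_distrib]
      refine le_trans ?_ (mul_le_mul_of_nonneg_right hsum.le (sq_nonneg _))
      rw [Finset.sum_mul]
      refine Finset.sum_le_sum fun i _ ↦ ?_
      rw [← Finset.sum_sub_distrib, Finset.sum_mul]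
      refine Finset.sum_le_sum fun j _ ↦ ?_
      rw [← mul_sub, mul_comm]
      refine (le_abs_self _).trans ?_
      rw [abs_mul, abs_mul, abs_sub_comm, sq]
      gcongr
      · exact PiLp.norm_apply_le w i
      · exact PiLp.norm_apply_le w j
    have hl0 : 0 < l ^ 2 := by positivity
    have : ‖w‖ ^ 2 ≤ (l * ‖mfderiv (𝓡 n) (𝓡 n) e.symm y w‖) ^ 2 := by
      rw [mul_pow]
      have h3 : (l ^ 2)⁻¹ * ‖w‖ ^ 2 ≤ ‖mfderiv (𝓡 n) (𝓡 n) e.symm y w‖ ^ 2 := by linarith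
      rwa [inv_mul_le_iff₀ hl0] at h3
    exact le_of_sq_le_sq this (by positivity)
  · rintro _ ⟨y, hy, rfl⟩
    exact (hball hy).2.1

end AlmostEuclidean

/-! ### Transplanting functions from a chart to the manifold -/

section Topology

variable {n : ℕ} {M : Type*} [TopologicalSpace M]
  {e : OpenPartialHomeomorph M (EuclideanSpace ℝ (Fin n))}
  {B C : Set (EuclideanSpace ℝ (Fin n))} {ψ : EuclideanSpace ℝ (Fin n) → ℝ}

theorem target_inter_preimage_image_symm (hC : C ⊆ e.target) (A : Set M) :
    e.target ∩ e.symm ⁻¹' (A ∩ e.symm '' C) = C ∩ e.symm ⁻¹' A := by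
  ext y
  constructor
  · rintro ⟨hy, hA, z, hz, hzy⟩
    exact ⟨e.symm.injOn (hC hz) hy hzy ▸ hz, hA⟩
  · rintro ⟨hy, hA⟩
    exact ⟨hC hy, hA, y, hy, rfl⟩

theorem isCompact_image_symm (hC : IsCompact C) (hCe : C ⊆ e.target) :
    IsCompact (e.symm '' C) :=
  hC.image_of_continuousOn (e.continuousOn_symm.mono hCe)

/-- The function on `M` which is `ψ` in the chart `e`, extended by zero. -/
noncomputable def transplant (e : OpenPartialHomeomorph M (EuclideanSpace ℝ (Fin n)))
    (ψ : EuclideanSpace ℝ (Fin n) → ℝ) : M → ℝ :=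
  e.source.indicator (ψ ∘ e)

theorem transplant_eventuallyEq {x : M} (hx : x ∈ e.source) :
    transplant e ψ =ᶠ[nhds x] ψ ∘ e := by
  filter_upwards [e.open_source.mem_nhds hx] with z hz
  exact indicator_of_mem hz _

variable [T2Space M]

theorem measurableSet_inter_preimage_symm (hC : IsCompact C) (hCe : C ⊆ e.target)
    [MeasurableSpace M] [BorelSpace M] {A : Set M} (hA : MeasurableSet A) :
    MeasurableSet (C ∩ e.symm ⁻¹' A) := by
  rw [← target_inter_preimage_image_symm hCe]
  exact measurableSet_chart e (hA.inter (isCompact_image_symm hC hCe).measurableSet)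

theorem tsupport_transplant_subset (hB : IsCompact B) (hBe : B ⊆ e.target)
    (hψB : tsupport ψ ⊆ B) : tsupport (transplant e ψ) ⊆ e.symm '' B := by
  refine closure_minimal ?_ (isCompact_image_symm hB hBe).isClosed
  intro x hx
  have hxs : x ∈ e.source := mem_of_indicator_ne_zero hx
  refine ⟨e x, hψB (subset_tsupport _ ?_), e.left_inv hxs⟩
  rwa [Function.mem_support, transplant, indicator_of_mem hxs] at hx

theorem transplant_mem_admissible [ChartedSpace (EuclideanSpace ℝ (Fin n)) M]
    [IsManifold (𝓡 n) ∞ M] {Ω : Set M}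
    (he : e ∈ IsManifold.maximalAtlas (𝓡 n) ∞ M)
    (hB : IsCompact B) (hBe : B ⊆ e.target) (hBΩ : e.symm '' B ⊆ Ω) (hψ : ContDiff ℝ 1 ψ)
    (hψB : tsupport ψ ⊆ B) (hψ0 : ∀ y, 0 ≤ ψ y) (hC : C ⊆ e.target) (hψC : ∀ y ∈ C, 1 ≤ ψ y) :
    transplant e ψ ∈ admissible n (e.symm '' C) Ω := by
  have hts := tsupport_transplant_subset hB hBe hψB
  refine ⟨fun x ↦ ?_, (isCompact_image_symm hB hBe).of_isClosed_subset (isClosed_tsupport _) hts,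
    hts.trans hBΩ, fun x ↦ ?_⟩
  · by_cases hx : x ∈ e.source
    · refine ContMDiffAt.congr_of_eventuallyEq ?_ (transplant_eventuallyEq hx)
      exact hψ.contMDiff.contMDiffAt.comp x
        ((contMDiffAt_of_mem_maximalAtlas he hx).of_le (by simp))
    · have hx' : x ∉ tsupport (transplant e ψ) := by
        intro h
        obtain ⟨y, hy, rfl⟩ := hts h
        exact hx (e.map_target (hBe hy))
      exact contMDiffAt_const.congr_of_eventuallyEq (notMem_tsupport_iff_eventuallyEq.1 hx')
  · by_cases hx : x ∈ e.symm '' C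
    · rw [indicator_of_mem hx]
      obtain ⟨y, hy, rfl⟩ := hx
      rw [transplant, indicator_of_mem (e.map_target (hC hy)), Function.comp,
        e.right_inv (hC hy)]
      exact hψC y hy
    · rw [indicator_of_notMem hx]
      exact indicator_nonneg (fun z _ ↦ hψ0 _) x

end Topology

section Transplant

variable {n : ℕ} {M : Type*} [TopologicalSpace M] [ChartedSpace (EuclideanSpace ℝ (Fin n)) M]
  [RiemannianBundle (fun x : M ↦ TangentSpace (𝓡 n) x)]
  {e : OpenPartialHomeomorph M (EuclideanSpace ℝ (Fin n))} {l : ℝ}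
  {B C : Set (EuclideanSpace ℝ (Fin n))} {ψ : EuclideanSpace ℝ (Fin n) → ℝ}

section Measure

variable [IsManifold (𝓡 n) ∞ M] [MeasurableSpace M] [BorelSpace M] [T2Space M]

theorem riemannianVolume_inter_image_symm (he : AlmostEuclideanOn e l B) (hC : IsCompact C)
    (hCB : C ⊆ B) {A : Set M} (hA : MeasurableSet A) :
    riemannianVolume n M (A ∩ e.symm '' C) = ∫⁻ y in C ∩ e.symm ⁻¹' A,
      ENNReal.ofReal (√(chartGram e y).det) := by
  have hCt := hCB.trans he.subset_target
  rw [riemannianVolume_apply he.mem_maximalAtlas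
    (hA.inter (isCompact_image_symm hC hCt).measurableSet), target_inter_preimage_image_symm hCt]
  rintro _ ⟨-, y, hy, rfl⟩
  exact e.map_target (hCt hy)

theorem le_riemannianVolume_image_symm (he : AlmostEuclideanOn e l B) (hC : IsCompact C)
    (hCB : C ⊆ B) :
    ENNReal.ofReal l⁻¹ * volume C ≤ riemannianVolume n M (e.symm '' C) := by
  have h := riemannianVolume_inter_image_symm he hC hCB MeasurableSet.univ
  rw [univ_inter, preimage_univ, inter_univ] at h
  rw [h, ← setLIntegral_const]
  exact setLIntegral_mono' hC.measurableSet fun y hy ↦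
    ENNReal.ofReal_le_ofReal (he.le_sqrt_det y (hCB hy))

theorem riemannianVolume_inter_image_symm_le (he : AlmostEuclideanOn e l B) (hC : IsCompact C)
    (hCB : C ⊆ B) {A : Set M} (hA : MeasurableSet A) :
    riemannianVolume n M (A ∩ e.symm '' C) ≤ ENNReal.ofReal l * volume (C ∩ e.symm ⁻¹' A) := by
  rw [riemannianVolume_inter_image_symm he hC hCB hA, ← setLIntegral_const]
  exact setLIntegral_mono'
    (measurableSet_inter_preimage_symm hC (hCB.trans he.subset_target) hA) fun y hy ↦
    ENNReal.ofReal_le_ofReal (he.sqrt_det_le y (hCB hy.1))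

theorem riemannianVolume_image_symm_le (he : AlmostEuclideanOn e l B) (hC : IsCompact C)
    (hCB : C ⊆ B) :
    riemannianVolume n M (e.symm '' C) ≤ ENNReal.ofReal l * volume C := by
  simpa using riemannianVolume_inter_image_symm_le he hC hCB MeasurableSet.univ

theorem restrict_riemannianVolume_le (he : AlmostEuclideanOn e l B) (hB : IsCompact B) :
    (riemannianVolume n M).restrict (e.symm '' B) ≤
      ENNReal.ofReal l • (volume.restrict B).map e.symm := by
  refine Measure.le_iff.2 fun A hA ↦ ?_
  have hm : AEMeasurable e.symm (volume.restrict B) :=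
    (e.continuousOn_symm.mono he.subset_target).aemeasurable hB.measurableSet
  rw [Measure.restrict_apply hA, Measure.smul_apply, Measure.map_apply_of_aemeasurable hm hA,
    Measure.restrict_apply₀' hB.measurableSet.nullMeasurableSet, inter_comm (e.symm ⁻¹' A)]
  exact riemannianVolume_inter_image_symm_le he hB Subset.rfl hA

/-- Integration in a chart, as an inequality. -/
theorem setLIntegral_riemannianVolume_le (he : AlmostEuclideanOn e l B) (hB : IsCompact B)
    (F : M → ℝ≥0∞) :
    ∫⁻ x in e.symm '' B, F x ∂(riemannianVolume n M) ≤
      ENNReal.ofReal l * ∫⁻ y in B, F (e.symm y) := by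
  refine (lintegral_mono' (restrict_riemannianVolume_le he hB) le_rfl).trans ?_
  rw [lintegral_smul_measure, smul_eq_mul]
  gcongr
  exact lintegral_map_le _ _

end Measure

/-- The gradient `v` of a transplanted function satisfies `⟪v, v⟫ = dψ (w)`, where `w` are the
coordinates of `v`, and `|w| ≤ l |v|`. -/
theorem norm_gradient_transplant_le [IsManifold (𝓡 n) ∞ M]
    (he : AlmostEuclideanOn e l B) (hψ : ContDiff ℝ 1 ψ) {y : EuclideanSpace ℝ (Fin n)}
    (hy : y ∈ B) :
    ‖gradient n (transplant e ψ) (e.symm y)‖ ≤ l * ‖fderiv ℝ ψ y‖ := by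
  have hyt := he.subset_target hy
  have hxs := e.map_target hyt
  set x := e.symm y with hx
  have hex : e x = y := e.right_inv hyt
  have h1 : MDifferentiableAt (𝓡 n) (𝓡 n) e x :=
    (contMDiffAt_of_mem_maximalAtlas he.mem_maximalAtlas hxs).mdifferentiableAt (by simp)
  have h2 : MDifferentiableAt (𝓡 n) (𝓡 n) e.symm y :=
    (contMDiffAt_symm_of_mem_maximalAtlas he.mem_maximalAtlas hyt).mdifferentiableAt (by simp)
  set v := gradient n (transplant e ψ) x with hv
  let w : EuclideanSpace ℝ (Fin n) := mfderiv (𝓡 n) (𝓡 n) e x v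
  have hdf : mfderiv (𝓡 n) 𝓘(ℝ, ℝ) (transplant e ψ) x v = fderiv ℝ ψ y w := by
    rw [(transplant_eventuallyEq hxs).mfderiv_eq]
    have hψx : HasMFDerivAt (𝓡 n) 𝓘(ℝ, ℝ) ψ (e x) (fderiv ℝ ψ (e x)) :=
      ((hψ.differentiable (by simp)) (e x)).hasFDerivAt.hasMFDerivAt
    have := (HasMFDerivAt.comp x hψx h1.hasMFDerivAt).mfderiv
    rw [← hex]
    exact DFunLike.congr_fun this v
  -- `v` is the tangent vector with coordinates `w`
  have hvw : (mfderiv (𝓡 n) (𝓡 n) e.symm y w : EuclideanSpace ℝ (Fin n)) = v := by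
    have hid : e.symm ∘ e =ᶠ[nhds x] id := by
      filter_upwards [e.open_source.mem_nhds hxs] with z hz
      exact e.left_inv hz
    have h2' : MDifferentiableAt (𝓡 n) (𝓡 n) e.symm (e x) := by rwa [hex]
    have hc := (HasMFDerivAt.comp x h2'.hasMFDerivAt h1.hasMFDerivAt).mfderiv
    rw [hid.mfderiv_eq, mfderiv_id] at hc
    have := DFunLike.congr_fun hc v
    rw [← hex]
    exact this.symm
  have hnorm : ‖w‖ ≤ l * ‖v‖ := by
    refine (he.norm_le y hy w).trans (le_of_eq ?_)
    rw [show mfderiv (𝓡 n) (𝓡 n) e.symm y w = v from hvw]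
  have hl : 0 ≤ l := (Real.sqrt_nonneg _).trans (he.sqrt_det_le y hy)
  have hsq : ‖v‖ * ‖v‖ ≤ l * ‖fderiv ℝ ψ y‖ * ‖v‖ := by
    rw [← real_inner_self_eq_norm_mul_norm, hv, inner_gradient, ← hv, hdf]
    calc fderiv ℝ ψ y w ≤ ‖fderiv ℝ ψ y‖ * ‖w‖ :=
          (le_abs_self _).trans ((fderiv ℝ ψ y).le_opNorm w)
      _ ≤ ‖fderiv ℝ ψ y‖ * (l * ‖v‖) := by gcongr
      _ = _ := by ring
  rcases (norm_nonneg v).eq_or_lt with h0 | h0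
  · rw [← h0]; positivity
  · exact le_of_mul_le_mul_right hsq h0

variable [T2Space M]

theorem gradient_transplant_eq_zero (hB : IsCompact B) (hBe : B ⊆ e.target)
    (hψB : tsupport ψ ⊆ B) {x : M} (hx : x ∉ e.symm '' B) :
    gradient n (transplant e ψ) x = 0 := by
  have hx' : x ∉ tsupport (transplant e ψ) := fun h ↦ hx (tsupport_transplant_subset hB hBe hψB h)
  have h0 : mfderiv (𝓡 n) 𝓘(ℝ, ℝ) (transplant e ψ) x = 0 := by
    rw [(notMem_tsupport_iff_eventuallyEq.1 hx').mfderiv_eq]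
    exact mfderiv_const
  rw [← inner_self_eq_zero (𝕜 := ℝ), inner_gradient, h0]
  rfl

end Transplant

/-! ### Capacity bounds from test functions -/

section CapacityBounds

variable {n : ℕ} {M : Type*} [TopologicalSpace M] [ChartedSpace (EuclideanSpace ℝ (Fin n)) M]
  [RiemannianBundle (fun x : M ↦ TangentSpace (𝓡 n) x)] [IsManifold (𝓡 n) ∞ M] [T2Space M]
  [MeasurableSpace M]
  {e : OpenPartialHomeomorph M (EuclideanSpace ℝ (Fin n))} {l : ℝ}
  {B C : Set (EuclideanSpace ℝ (Fin n))} {Ω : Set M} {ψ : EuclideanSpace ℝ (Fin n) → ℝ}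

/-- A test function in an almost Euclidean chart bounds the `p`-capacity by almost its Euclidean
`p`-energy. -/
theorem relCap_image_symm_le [BorelSpace M] (he : AlmostEuclideanOn e l B) (hB : IsCompact B)
    (hBΩ : e.symm '' B ⊆ Ω) (hψ : ContDiff ℝ 1 ψ) (hψB : tsupport ψ ⊆ B) (hψ0 : ∀ y, 0 ≤ ψ y)
    (hC : C ⊆ B) (hψC : ∀ y ∈ C, 1 ≤ ψ y) {p : ℝ} (hp : 0 < p) :
    relCap n (ENNReal.ofReal p) (e.symm '' C) Ω ≤
      ENNReal.ofReal l * ∫⁻ y in B, ENNReal.ofReal (l * ‖fderiv ℝ ψ y‖) ^ p := by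
  have hadm := transplant_mem_admissible he.mem_maximalAtlas hB he.subset_target hBΩ hψ hψB hψ0
    (hC.trans he.subset_target) hψC
  rw [relCap, if_neg ENNReal.ofReal_ne_top, ENNReal.toReal_ofReal hp.le]
  refine (iInf₂_le _ hadm).trans ((setLIntegral_le_lintegral _ _).trans ?_)
  -- the energy lives on the image of `B`; positivity of `p` matters, since `0 ^ 0 = 1`
  have hzero : (fun x ↦ ‖gradient n (transplant e ψ) x‖ₑ ^ p) =
      (e.symm '' B).indicator fun x ↦ ‖gradient n (transplant e ψ) x‖ₑ ^ p := by
    refine (indicator_eq_self.2 fun x hx ↦ ?_).symm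
    by_contra h
    refine hx ?_
    simp [gradient_transplant_eq_zero hB he.subset_target hψB h, hp]
  rw [hzero, lintegral_indicator (isCompact_image_symm hB he.subset_target).measurableSet]
  refine (setLIntegral_riemannianVolume_le he hB _).trans ?_
  gcongr 1
  refine setLIntegral_mono' hB.measurableSet fun y hy ↦ ?_
  gcongr
  rw [← ofReal_norm]
  exact ENNReal.ofReal_le_ofReal (norm_gradient_transplant_le he hψ hy)

theorem relCap_top_image_symm_le (he : AlmostEuclideanOn e l B) (hB : IsCompact B)
    (hBΩ : e.symm '' B ⊆ Ω) (hψ : ContDiff ℝ 1 ψ) (hψB : tsupport ψ ⊆ B) (hψ0 : ∀ y, 0 ≤ ψ y)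
    (hC : C ⊆ B) (hψC : ∀ y ∈ C, 1 ≤ ψ y) {D : ℝ} (hl : 0 ≤ l)
    (hD : ∀ y, ‖fderiv ℝ ψ y‖ ≤ D) :
    relCap n ⊤ (e.symm '' C) Ω ≤ ENNReal.ofReal (l * D) := by
  have hadm := transplant_mem_admissible he.mem_maximalAtlas hB he.subset_target hBΩ hψ hψB hψ0
    (hC.trans he.subset_target) hψC
  rw [relCap, if_pos rfl]
  refine (iInf₂_le _ hadm).trans (iSup₂_le fun x _ ↦ ?_)
  by_cases hx : x ∈ e.symm '' B
  · obtain ⟨y, hy, rfl⟩ := hx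
    rw [← ofReal_norm]
    refine ENNReal.ofReal_le_ofReal ((norm_gradient_transplant_le he hψ hy).trans ?_)
    gcongr
    exact hD y
  · simp [gradient_transplant_eq_zero hB he.subset_target hψB hx]

end CapacityBounds

/-! ### Test functions on Euclidean space -/

section TestFunctions

variable {E : Type*} [NormedAddCommGroup E] [InnerProductSpace ℝ E]

/-- Cutoff functions of concentric balls of radii `r` and `2 * r`, with gradient at most `D / r`
for a constant `D` independent of `r`. -/
theorem exists_scaled_bump (E : Type*) [NormedAddCommGroup E] [InnerProductSpace ℝ E]
    [FiniteDimensional ℝ E] :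
    ∃ D : ℝ, 0 ≤ D ∧ ∀ r : ℝ, 0 < r → ∃ ψ : E → ℝ, ContDiff ℝ 1 ψ ∧
      tsupport ψ ⊆ Metric.closedBall 0 (2 * r) ∧ (∀ y, 0 ≤ ψ y) ∧
      (∀ y ∈ Metric.closedBall (0 : E) r, 1 ≤ ψ y) ∧ ∀ y, ‖fderiv ℝ ψ y‖ ≤ D / r := by
  let f : ContDiffBump (0 : E) := ⟨1, 2, one_pos, one_lt_two⟩
  have hf : ContDiff ℝ 1 f := f.contDiff
  obtain ⟨D, hD⟩ := (hf.continuous_fderiv (by simp)).bounded_above_of_compact_support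
    (f.hasCompactSupport.fderiv ℝ)
  refine ⟨D, (norm_nonneg _).trans (hD 0), fun r hr ↦
    ⟨fun y ↦ f (r⁻¹ • y), hf.comp (contDiff_const_smul _), ?_, fun y ↦ f.nonneg, ?_, ?_⟩⟩
  · refine closure_minimal (fun y hy ↦ ?_) Metric.isClosed_closedBall
    have : r⁻¹ • y ∈ Function.support f := hy
    rw [f.support_eq, mem_ball_zero_iff, norm_smul, norm_inv, Real.norm_of_nonneg hr.le,
      inv_mul_lt_iff₀ hr] at this
    rw [mem_closedBall_zero_iff, mul_comm]
    exact this.le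
  · intro y hy
    refine (f.one_of_mem_closedBall ?_).ge
    rw [mem_closedBall_zero_iff] at hy ⊢
    rw [norm_smul, norm_inv, Real.norm_of_nonneg hr.le, inv_mul_le_iff₀ hr]
    simpa [f] using hy
  · intro y
    have h1 : HasFDerivAt (fun y : E ↦ r⁻¹ • y) (r⁻¹ • ContinuousLinearMap.id ℝ E) y :=
      (hasFDerivAt_id y).const_smul _
    have h2 : HasFDerivAt (fun y : E ↦ f (r⁻¹ • y)) _ y :=
      ((hf.differentiable (by simp)) (r⁻¹ • y)).hasFDerivAt.comp y h1
    rw [h2.fderiv, ContinuousLinearMap.comp_smul, ContinuousLinearMap.comp_id, norm_smul, norm_inv,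
      Real.norm_of_nonneg hr.le, div_eq_inv_mul]
    gcongr
    exact hD _

/-- A `C¹` transition function from `0` on `(-∞, 0]` to a constant at least `1` on `[1, ∞)`, with
slope at most `l`, for `l > 1`: the primitive of a trapezoid of height `l`. -/
theorem exists_steep_transition {l : ℝ} (hl : 1 < l) :
    ∃ φ h : ℝ → ℝ, (∀ s, HasDerivAt φ (h s) s) ∧ Continuous h ∧ (∀ s, |h s| ≤ l) ∧
      (∀ s ≤ 0, φ s = 0) ∧ (∀ s, 1 ≤ s → φ s = φ 1) ∧ 1 ≤ φ 1 ∧ ∀ s, 0 ≤ φ s := by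
  -- the trapezoid has a plateau on `[δ, 1 - δ]`, of length `l⁻¹`
  set δ : ℝ := (1 - l⁻¹) / 2 with hδ
  have hl0 : 0 < l := by linarith
  have hl1 : l⁻¹ < 1 := inv_lt_one_of_one_lt₀ hl
  have hli : 0 < l⁻¹ := inv_pos.2 hl0
  have hδ0 : 0 < δ := by rw [hδ]; linarith
  have hδ1 : δ ≤ 1 - δ := by rw [hδ]; linarith
  let h : ℝ → ℝ := fun s ↦ l * max 0 (min 1 (min (s / δ) ((1 - s) / δ)))
  have hc : Continuous h := by fun_prop
  have h0 : ∀ s, 0 ≤ h s := fun s ↦ mul_nonneg hl0.le (le_max_left _ _)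
  have hle : ∀ s, h s ≤ l := fun s ↦
    mul_le_of_le_one_right hl0.le (max_le zero_le_one (min_le_left _ _))
  have hz : ∀ s, s ≤ 0 ∨ 1 ≤ s → h s = 0 := by
    intro s hs
    have : min 1 (min (s / δ) ((1 - s) / δ)) ≤ 0 := by
      refine (min_le_right _ _).trans ?_
      rcases hs with hs | hs
      · exact (min_le_left _ _).trans (div_nonpos_of_nonpos_of_nonneg hs hδ0.le)
      · exact (min_le_right _ _).trans (div_nonpos_of_nonpos_of_nonneg (by linarith) hδ0.le)
    simp only [h]
    rw [max_eq_left this, mul_zero]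
  have hpl : ∀ s ∈ Icc δ (1 - δ), h s = l := by
    intro s hs
    have h1 : 1 ≤ s / δ := (one_le_div hδ0).2 hs.1
    have h2 : 1 ≤ (1 - s) / δ := (one_le_div hδ0).2 (by linarith [hs.2])
    simp only [h]
    rw [min_eq_left (le_min h1 h2), max_eq_right zero_le_one, mul_one]
  have hint : ∀ a b, IntervalIntegrable h volume a b := fun a b ↦ hc.intervalIntegrable a b
  let φ : ℝ → ℝ := fun s ↦ ∫ t in (0 : ℝ)..s, h t
  have hφ0 : ∀ s ≤ 0, φ s = 0 := by
    intro s hs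
    have : ∫ t in (0 : ℝ)..s, h t = ∫ t in (0 : ℝ)..s, (0 : ℝ) := by
      refine intervalIntegral.integral_congr fun t ht ↦ hz t (Or.inl ?_)
      rw [uIcc_of_ge hs] at ht
      exact ht.2
    simp only [φ]
    rw [this, intervalIntegral.integral_zero]
  refine ⟨φ, h, fun s ↦ ?_, hc, fun s ↦ ?_, hφ0, ?_, ?_, ?_⟩
  · exact intervalIntegral.integral_hasDerivAt_right (hint 0 s)
      hc.aestronglyMeasurable.stronglyMeasurableAtFilter hc.continuousAt
  · rw [abs_of_nonneg (h0 s)]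
    exact hle s
  · intro s hs
    have : ∫ t in (1 : ℝ)..s, h t = ∫ t in (1 : ℝ)..s, (0 : ℝ) := by
      refine intervalIntegral.integral_congr fun t ht ↦ hz t (Or.inr ?_)
      rw [uIcc_of_le hs] at ht
      exact ht.1
    simp only [φ]
    rw [← intervalIntegral.integral_add_adjacent_intervals (hint 0 1) (hint 1 s), this,
      intervalIntegral.integral_zero, add_zero]
  · have h1 : ∫ t in δ..(1 - δ), h t = 1 := by
      have : ∫ t in δ..(1 - δ), h t = ∫ t in δ..(1 - δ), l := by
        refine intervalIntegral.integral_congr fun t ht ↦ ?_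
        rw [uIcc_of_le hδ1] at ht
        exact hpl t ht
      rw [this, intervalIntegral.integral_const, smul_eq_mul, hδ]
      field_simp
      ring
    exact h1.ge.trans <| intervalIntegral.integral_mono_interval hδ0.le hδ1 (by linarith)
      (Filter.Eventually.of_forall h0) (hint 0 1)
  · intro s
    rcases le_total s 0 with hs | hs
    · exact (hφ0 s hs).ge
    · exact intervalIntegral.integral_nonneg hs fun t _ ↦ h0 t

/-- A `C¹` approximation of the extremal function `log (R / |y|) / log (R / r)` of the conformal
condenser of two concentric balls of radii `r < R`. -/
theorem exists_log_cutoff {l r R : ℝ} (hl : 1 < l) (hr : 0 < r) (hrR : r < R) :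
    ∃ ψ : E → ℝ, ContDiff ℝ 1 ψ ∧ tsupport ψ ⊆ Metric.closedBall 0 R ∧ (∀ y, 0 ≤ ψ y) ∧
      (∀ y ∈ Metric.closedBall (0 : E) r, 1 ≤ ψ y) ∧
      ∀ y, ‖fderiv ℝ ψ y‖ ≤ (Icc r R).indicator (fun t ↦ l / (Real.log (R / r) * t)) ‖y‖ := by
  obtain ⟨φ, h, hφ, hh, hhl, hφ0, hφ1, hφ1', hφnn⟩ := exists_steep_transition hl
  have hR : 0 < R := hr.trans hrR
  have hL : 0 < Real.log (R / r) := Real.log_pos ((one_lt_div hr).2 hrR)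
  set L := Real.log (R / r) with hLdef
  -- the truncation of `‖y‖` below by `r` keeps the logarithm away from its junk value at `0`
  let ψ : E → ℝ := fun y ↦ φ (Real.log (R / max ‖y‖ r) / L)
  have hin : ∀ y : E, ‖y‖ ≤ r → ψ y = φ 1 := by
    intro y hy
    simp only [ψ]
    rw [max_eq_right hy, ← hLdef, div_self hL.ne']
  have hout : ∀ y : E, y ≠ 0 → ψ y = φ (Real.log (R / ‖y‖) / L) := by
    intro y hy
    rcases le_total ‖y‖ r with h1 | h1
    · rw [hin y h1]
      refine (hφ1 _ ?_).symm
      rw [one_le_div hL, hLdef]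
      have := norm_pos_iff.2 hy
      gcongr
    · simp only [ψ]
      rw [max_eq_left h1]
  have hzero : ∀ y : E, R ≤ ‖y‖ → ψ y = 0 := by
    intro y hy
    have hy0 : 0 < ‖y‖ := hR.trans_le hy
    rw [hout y (norm_pos_iff.1 hy0)]
    refine hφ0 _ (div_nonpos_of_nonpos_of_nonneg (Real.log_nonpos (by positivity) ?_) hL.le)
    exact (div_le_one hy0).2 hy
  have hev_in : ∀ y : E, ‖y‖ < r → ψ =ᶠ[nhds y] fun _ ↦ φ 1 := by
    intro y hy
    filter_upwards [continuous_norm.continuousAt.eventually_lt_const hy] with z hz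
    exact hin z hz.le
  have hev_out : ∀ y : E, y ≠ 0 → ψ =ᶠ[nhds y] fun z ↦ φ (Real.log (R / ‖z‖) / L) := by
    intro y hy
    filter_upwards [isOpen_ne.mem_nhds hy] with z hz
    exact hout z hz
  have hφd : ContDiff ℝ 1 φ := by
    rw [contDiff_one_iff_deriv]
    refine ⟨fun s ↦ (hφ s).differentiableAt, ?_⟩
    rwa [show deriv φ = h from funext fun s ↦ (hφ s).deriv]
  refine ⟨ψ, ?_, ?_, fun y ↦ hφnn _, ?_, ?_⟩
  · refine contDiff_iff_contDiffAt.2 fun y ↦ ?_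
    by_cases hy : y = 0
    · exact contDiffAt_const.congr_of_eventuallyEq (hev_in y (by simpa [hy] using hr))
    · refine ContDiffAt.congr_of_eventuallyEq ?_ (hev_out y hy)
      have hy0 : ‖y‖ ≠ 0 := norm_ne_zero_iff.2 hy
      refine hφd.contDiffAt.comp y ((ContDiffAt.log ?_ ?_).div_const _)
      · exact contDiffAt_const.div (contDiffAt_norm ℝ hy) hy0
      · exact div_ne_zero hR.ne' hy0
  · refine closure_minimal (fun y hy ↦ ?_) Metric.isClosed_closedBall
    rw [mem_closedBall_zero_iff]
    by_contra hcon
    exact hy (hzero y (not_le.1 hcon).le)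
  · intro y hy
    rw [mem_closedBall_zero_iff] at hy
    rwa [hin y hy]
  · intro y
    by_cases hy : ‖y‖ ∈ Icc r R
    · rw [indicator_of_mem hy]
      have hy0 : 0 < ‖y‖ := hr.trans_le hy.1
      have hyne := norm_pos_iff.1 hy0
      have hlog : HasDerivAt (fun t : ℝ ↦ Real.log (R / t) / L) (-(1 / ‖y‖) / L) ‖y‖ := by
        have h1 : HasDerivAt (fun t : ℝ ↦ (Real.log R - Real.log t) / L)
            ((0 - ‖y‖⁻¹) / L) ‖y‖ :=
          ((hasDerivAt_const _ _).sub (Real.hasDerivAt_log hy0.ne')).div_const L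
        have h2 : (fun t : ℝ ↦ Real.log (R / t) / L) =ᶠ[nhds ‖y‖]
            fun t ↦ (Real.log R - Real.log t) / L := by
          filter_upwards [lt_mem_nhds hy0] with t ht
          rw [Real.log_div hR.ne' ht.ne']
        have h3 := h1.congr_of_eventuallyEq h2
        rwa [zero_sub, ← one_div] at h3
      have hnorm : HasFDerivAt (fun z : E ↦ ‖z‖) (fderiv ℝ (fun z : E ↦ ‖z‖) y) y :=
        ((contDiffAt_norm ℝ hyne (n := 1)).differentiableAt (by simp)).hasFDerivAt
      have hnl : ‖fderiv ℝ (fun z : E ↦ ‖z‖) y‖ ≤ 1 := by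
        simpa using norm_fderiv_le_of_lipschitz ℝ (lipschitzWith_one_norm (E := E)) (x₀ := y)
      have hcomp := ((hφ _).comp ‖y‖ hlog).comp_hasFDerivAt y hnorm
      have := (hcomp.congr_of_eventuallyEq (hev_out y hyne)).fderiv
      rw [this, norm_smul, Real.norm_eq_abs, abs_mul]
      calc _ ≤ l * |(-(1 / ‖y‖) / L)| * 1 := by
            gcongr
            exact hhl _
        _ = l / (L * ‖y‖) := by
            rw [abs_div, abs_neg, abs_of_pos hL, abs_of_pos (by positivity)]
            field_simp
    · rw [indicator_of_notMem hy]
      have hfd : fderiv ℝ ψ y = 0 := by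
        rcases lt_or_ge ‖y‖ r with h1 | h1
        · rw [(hev_in y h1).fderiv_eq]
          simp
        · have h2 : R < ‖y‖ := by
            by_contra hcon
            exact hy ⟨h1, not_lt.1 hcon⟩
          have h3 : ψ =ᶠ[nhds y] fun _ ↦ 0 := by
            filter_upwards [continuous_norm.continuousAt.eventually_const_lt h2] with z hz
            exact hzero z hz.le
          rw [h3.fderiv_eq]
          simp
      rw [hfd, norm_zero]

/-- The conformal energy of the radial function with derivative `a / |y|` between the spheres of
radii `r` and `R`. -/
theorem lintegral_indicator_norm_pow {n : ℕ} (hn : 1 ≤ n) {a r R : ℝ} (ha : 0 ≤ a) (hr : 0 < r)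
    (hrR : r < R) :
    ∫⁻ y : EuclideanSpace ℝ (Fin n), ENNReal.ofReal ((Icc r R).indicator (fun t ↦ a / t) ‖y‖) ^ n =
      ENNReal.ofReal (n * unitBallVolume n * a ^ n * Real.log (R / r)) := by
  have : Nonempty (Fin n) := ⟨⟨0, hn⟩⟩
  let G : ℝ → ℝ := (Icc r R).indicator fun t ↦ (a / t) ^ n
  have hG0 : ∀ t, 0 ≤ G t := fun t ↦ indicator_nonneg (fun s hs ↦
    pow_nonneg (div_nonneg ha (hr.le.trans hs.1)) n) t
  have hGeq : ∀ t, ENNReal.ofReal ((Icc r R).indicator (fun t ↦ a / t) t) ^ n =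
      ENNReal.ofReal (G t) := by
    intro t
    by_cases ht : t ∈ Icc r R
    · simp only [G]
      rw [indicator_of_mem ht, indicator_of_mem ht,
        ENNReal.ofReal_pow (div_nonneg ha (hr.le.trans ht.1))]
    · simp only [G]
      rw [indicator_of_notMem ht, indicator_of_notMem ht]
      simp [show n ≠ 0 by omega]
  have hmul : (fun t : ℝ ↦ t ^ (n - 1) • G t) = (Icc r R).indicator fun t ↦ a ^ n * t⁻¹ := by
    ext t
    by_cases ht : t ∈ Icc r R
    · have ht0 : 0 < t := hr.trans_le ht.1
      simp only [G]
      rw [indicator_of_mem ht, indicator_of_mem ht, smul_eq_mul, div_pow]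
      obtain ⟨m, rfl⟩ : ∃ m, n = m + 1 := ⟨n - 1, by omega⟩
      rw [Nat.add_sub_cancel]
      field_simp
      ring
    · simp only [G]
      rw [indicator_of_notMem ht, indicator_of_notMem ht, smul_zero]
  have hint : IntegrableOn (fun t : ℝ ↦ a ^ n * t⁻¹) (Icc r R) := by
    refine ContinuousOn.integrableOn_compact isCompact_Icc (continuousOn_const.mul ?_)
    exact continuousOn_inv₀.mono fun t ht ↦ (hr.trans_le ht.1).ne'
  have hsub : Icc r R ⊆ Ioi 0 := fun t ht ↦ hr.trans_le ht.1
  have hdim : Module.finrank ℝ (EuclideanSpace ℝ (Fin n)) = n := finrank_euclideanSpace_fin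
  have hI : Integrable (fun y : EuclideanSpace ℝ (Fin n) ↦ G ‖y‖) := by
    rw [integrable_fun_norm_addHaar, hdim, hmul]
    exact (hint.integrable_indicator measurableSet_Icc).integrableOn
  simp_rw [hGeq]
  rw [← ofReal_integral_eq_lintegral_ofReal hI (Filter.Eventually.of_forall fun y ↦ hG0 _),
    integral_fun_norm_addHaar, hdim, hmul, setIntegral_indicator measurableSet_Icc,
    inter_eq_self_of_subset_right hsub, integral_Icc_eq_integral_Ioc,
    ← intervalIntegral.integral_of_le hrR.le, intervalIntegral.integral_const_mul,
    integral_inv_of_pos hr (hr.trans hrR), nsmul_eq_mul, smul_eq_mul, unitBallVolume]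
  congr 1
  ring

end TestFunctions

/-! ### Volume and capacity of small balls -/

theorem unitBallVolume_pos (n : ℕ) : 0 < unitBallVolume n :=
  ENNReal.toReal_pos (Metric.measure_ball_pos _ _ one_pos).ne' measure_ball_lt_top.ne

theorem volume_closedBall_eq (n : ℕ) {r : ℝ} (hr : 0 ≤ r) :
    volume (Metric.closedBall (0 : EuclideanSpace ℝ (Fin n)) r) =
      ENNReal.ofReal (unitBallVolume n * r ^ n) := by
  rw [Measure.addHaar_closedBall _ _ hr, finrank_euclideanSpace_fin, mul_comm,
    ENNReal.ofReal_mul (unitBallVolume_pos n).le, unitBallVolume,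
    ofReal_measureReal measure_ball_lt_top.ne]

theorem rpow_le_rpow_of_nonpos {x y : ℝ≥0∞} {z : ℝ} (hz : z ≤ 0) (h : x ≤ y) :
    y ^ z ≤ x ^ z := by
  rw [← neg_neg z, ENNReal.rpow_neg, ENNReal.rpow_neg x]
  exact ENNReal.inv_le_inv.2 (ENNReal.rpow_le_rpow h (neg_nonneg.2 hz))

theorem iInf_eq_zero_of_le_rpow {α : Type*} {S : Set α} {F : α → ℝ≥0∞} {c γ R : ℝ} (hγ : 0 < γ)
    (hR : 0 < R) (h : ∀ r, 0 < r → r < R → ∃ K ∈ S, F K ≤ ENNReal.ofReal (c * r ^ γ)) :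
    ⨅ K ∈ S, F K = 0 := by
  refine le_antisymm ?_ bot_le
  have hlim : Filter.Tendsto (fun r : ℝ ↦ ENNReal.ofReal (c * r ^ γ)) (nhdsWithin 0 (Ioi 0))
      (nhds 0) := by
    have h1 : ContinuousAt (fun r : ℝ ↦ c * r ^ γ) 0 :=
      (Real.continuousAt_rpow_const 0 γ (Or.inr hγ.le)).const_mul c
    have h2 := (ENNReal.continuous_ofReal.continuousAt.comp h1).tendsto
    simp only [Function.comp, Real.zero_rpow hγ.ne', mul_zero, ENNReal.ofReal_zero] at h2
    exact h2.mono_left nhdsWithin_le_nhds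
  refine ge_of_tendsto hlim ?_
  filter_upwards [Ioo_mem_nhdsGT hR] with r hr
  obtain ⟨K, hK, hF⟩ := h r hr.1 hr.2
  exact (iInf₂_le K hK).trans hF

section Balls

variable {n : ℕ} {M : Type*} [TopologicalSpace M] [ChartedSpace (EuclideanSpace ℝ (Fin n)) M]
  [RiemannianBundle (fun x : M ↦ TangentSpace (𝓡 n) x)]
  {e : OpenPartialHomeomorph M (EuclideanSpace ℝ (Fin n))} {l R : ℝ} {Ω : Set M}

theorem AlmostEuclideanOn.mono {B B' : Set (EuclideanSpace ℝ (Fin n))}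
    (he : AlmostEuclideanOn e l B) (h : B' ⊆ B) : AlmostEuclideanOn e l B' :=
  ⟨he.mem_maximalAtlas, h.trans he.subset_target, fun y hy ↦ he.norm_le y (h hy),
    fun y hy ↦ he.le_sqrt_det y (h hy), fun y hy ↦ he.sqrt_det_le y (h hy)⟩

variable [IsManifold (𝓡 n) ∞ M] [T2Space M] [MeasurableSpace M]

/-- The `∞`-capacity of small balls is bounded uniformly in the radius. -/
theorem relCap_top_ball_le (he : AlmostEuclideanOn e l (Metric.closedBall 0 R)) (hR : 0 < R)
    (hl : 1 < l) (hΩ : e.symm '' Metric.closedBall 0 R ⊆ Ω) :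
    ∃ c : ℝ, 0 ≤ c ∧ ∀ r : ℝ, 0 < r → r ≤ R / 2 →
      relCap n ⊤ (e.symm '' Metric.closedBall 0 r) Ω ≤ ENNReal.ofReal c := by
  obtain ⟨D, hD0, hD⟩ := exists_scaled_bump (EuclideanSpace ℝ (Fin n))
  obtain ⟨ψ, hψ, hψB, hψ0, hψ1, hψD⟩ := hD (R / 2) (by linarith)
  rw [mul_div_cancel₀ R two_ne_zero] at hψB
  refine ⟨l * (D / (R / 2)), by positivity, fun r hr hrR ↦ ?_⟩
  exact relCap_top_image_symm_le he (isCompact_closedBall _ _) hΩ hψ hψB hψ0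
    (Metric.closedBall_subset_closedBall (by linarith))
    (fun y hy ↦ hψ1 y (Metric.closedBall_subset_closedBall hrR hy)) (by linarith) hψD

variable [BorelSpace M]

theorem riemannianVolume_ball_le (he : AlmostEuclideanOn e l (Metric.closedBall 0 R))
    (hl : 1 < l) {r : ℝ} (hr : 0 < r) (hrR : r ≤ R) :
    riemannianVolume n M (e.symm '' Metric.closedBall 0 r) ≤
      ENNReal.ofReal (l * unitBallVolume n * r ^ n) := by
  rw [mul_assoc, ENNReal.ofReal_mul (by linarith), ← volume_closedBall_eq n hr.le]
  exact riemannianVolume_image_symm_le he (isCompact_closedBall _ _)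
    (Metric.closedBall_subset_closedBall hrR)

theorem le_riemannianVolume_ball (he : AlmostEuclideanOn e l (Metric.closedBall 0 R))
    (hl : 1 < l) {r : ℝ} (hr : 0 < r) (hrR : r ≤ R) :
    ENNReal.ofReal (l⁻¹ * unitBallVolume n * r ^ n) ≤
      riemannianVolume n M (e.symm '' Metric.closedBall 0 r) := by
  rw [mul_assoc, ENNReal.ofReal_mul (by positivity), ← volume_closedBall_eq n hr.le]
  exact le_riemannianVolume_image_symm he (isCompact_closedBall _ _)
    (Metric.closedBall_subset_closedBall hrR)

theorem ball_mem_compactSubsets (he : AlmostEuclideanOn e l (Metric.closedBall 0 R))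
    (hl : 1 < l) (hΩ : e.symm '' Metric.closedBall 0 R ⊆ Ω) {r : ℝ} (hr : 0 < r) (hrR : r ≤ R) :
    e.symm '' Metric.closedBall 0 r ∈ compactSubsets n Ω := by
  have hsub := Metric.closedBall_subset_closedBall (x := (0 : EuclideanSpace ℝ (Fin n))) hrR
  refine ⟨isCompact_image_symm (isCompact_closedBall _ _) (hsub.trans he.subset_target),
    (image_mono hsub).trans hΩ, lt_of_lt_of_le ?_ (le_riemannianVolume_ball he hl hr hrR)⟩
  have := unitBallVolume_pos n
  exact ENNReal.ofReal_pos.2 (by positivity)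

/-- Volumes of small balls are comparable to `r ^ n`, in the form needed for powers of either
sign. -/
theorem exists_riemannianVolume_ball_rpow_le
    (he : AlmostEuclideanOn e l (Metric.closedBall 0 R)) (hl : 1 < l) (α : ℝ) :
    ∃ c : ℝ, 0 < c ∧ ∀ r : ℝ, 0 < r → r ≤ R →
      riemannianVolume n M (e.symm '' Metric.closedBall 0 r) ^ (-α) ≤
        ENNReal.ofReal ((c * r ^ n) ^ (-α)) := by
  have hν := unitBallVolume_pos n
  rcases le_total 0 α with hα | hα
  · refine ⟨l⁻¹ * unitBallVolume n, by positivity, fun r hr hrR ↦ ?_⟩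
    rw [← ENNReal.ofReal_rpow_of_pos (by positivity)]
    exact rpow_le_rpow_of_nonpos (by linarith) (le_riemannianVolume_ball he hl hr hrR)
  · refine ⟨l * unitBallVolume n, by positivity, fun r hr hrR ↦ ?_⟩
    rw [← ENNReal.ofReal_rpow_of_pos (by positivity)]
    exact ENNReal.rpow_le_rpow (riemannianVolume_ball_le he hl hr hrR) (by linarith)

/-- The scaling `cap_p (K_r) ≤ c r ^ (n - p)` of the capacity of small balls. -/
theorem exists_relCap_ball_le (he : AlmostEuclideanOn e l (Metric.closedBall 0 R))
    (hl : 1 < l) (hΩ : e.symm '' Metric.closedBall 0 R ⊆ Ω) {p : ℝ} (hp : 0 < p) :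
    ∃ c : ℝ, 0 ≤ c ∧ ∀ r : ℝ, 0 < r → 2 * r ≤ R →
      relCap n (ENNReal.ofReal p) (e.symm '' Metric.closedBall 0 r) Ω ≤
        ENNReal.ofReal (c * r ^ ((n : ℝ) - p)) := by
  obtain ⟨D, hD0, hD⟩ := exists_scaled_bump (EuclideanSpace ℝ (Fin n))
  have hν := unitBallVolume_pos n
  refine ⟨l * ((l * D) ^ p * (unitBallVolume n * 2 ^ n)), by positivity, fun r hr hrR ↦ ?_⟩
  obtain ⟨ψ, hψ, hψB, hψ0, hψ1, hψD⟩ := hD r hr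
  have hsub := Metric.closedBall_subset_closedBall (x := (0 : EuclideanSpace ℝ (Fin n))) hrR
  refine (relCap_image_symm_le (he.mono hsub) (isCompact_closedBall _ _)
    ((image_mono hsub).trans hΩ) hψ hψB hψ0
    (Metric.closedBall_subset_closedBall (by linarith)) hψ1 hp).trans ?_
  calc ENNReal.ofReal l * ∫⁻ y in Metric.closedBall 0 (2 * r),
        ENNReal.ofReal (l * ‖fderiv ℝ ψ y‖) ^ p
      ≤ ENNReal.ofReal l * ∫⁻ y in Metric.closedBall (0 : EuclideanSpace ℝ (Fin n)) (2 * r),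
          ENNReal.ofReal (l * (D / r)) ^ p := by
        gcongr with y
        exact hψD y
    _ = ENNReal.ofReal (l * ((l * (D / r)) ^ p * (unitBallVolume n * (2 * r) ^ n))) := by
        rw [setLIntegral_const, volume_closedBall_eq n (by positivity),
          ENNReal.ofReal_rpow_of_nonneg (by positivity) hp.le,
          ← ENNReal.ofReal_mul (by positivity), ← ENNReal.ofReal_mul (by positivity)]
    _ = _ := by
        congr 1
        rw [← mul_div_assoc, Real.div_rpow (by positivity) hr.le, Real.rpow_sub hr,
          Real.rpow_natCast, mul_pow]
        ring

/-- The conformal capacity of a small ball is at most almost that of a Euclidean condenser of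
concentric balls, `n ν_n (log (R / r)) ^ (1 - n)`. -/
theorem relCap_conformal_ball_le (hn : 1 ≤ n)
    (he : AlmostEuclideanOn e l (Metric.closedBall 0 R))
    (hl : 1 < l) (hΩ : e.symm '' Metric.closedBall 0 R ⊆ Ω) {r : ℝ} (hr : 0 < r) (hrR : r < R) :
    relCap n (n : ℝ≥0∞) (e.symm '' Metric.closedBall 0 r) Ω ≤
      ENNReal.ofReal (l ^ (2 * n + 1) * (n * unitBallVolume n) *
        Real.log (R / r) ^ (1 - (n : ℝ))) := by
  have hL : 0 < Real.log (R / r) := Real.log_pos ((one_lt_div hr).2 hrR)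
  obtain ⟨ψ, hψ, hψB, hψ0, hψ1, hψD⟩ :=
    exists_log_cutoff (E := EuclideanSpace ℝ (Fin n)) hl hr hrR
  set L := Real.log (R / r) with hLdef
  have hl0 : 0 < l := by linarith
  have h := relCap_image_symm_le he (isCompact_closedBall _ _) hΩ hψ hψB hψ0
    (Metric.closedBall_subset_closedBall hrR.le) hψ1 (p := n) (by exact_mod_cast hn)
  rw [ENNReal.ofReal_natCast] at h
  refine h.trans ?_
  calc ENNReal.ofReal l * ∫⁻ y in Metric.closedBall 0 R,
        ENNReal.ofReal (l * ‖fderiv ℝ ψ y‖) ^ (n : ℝ)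
      ≤ ENNReal.ofReal l * ∫⁻ y : EuclideanSpace ℝ (Fin n),
          ENNReal.ofReal ((Icc r R).indicator (fun t ↦ l * l / L / t) ‖y‖) ^ n := by
        gcongr 1
        refine (setLIntegral_le_lintegral _ _).trans (lintegral_mono fun y ↦ ?_)
        rw [ENNReal.rpow_natCast]
        gcongr
        refine (mul_le_mul_of_nonneg_left (hψD y) hl0.le).trans (le_of_eq ?_)
        by_cases hy : ‖y‖ ∈ Icc r R
        · rw [indicator_of_mem hy, indicator_of_mem hy]
          field_simp
        · rw [indicator_of_notMem hy, indicator_of_notMem hy, mul_zero]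
    _ = ENNReal.ofReal (l * (n * unitBallVolume n * (l * l / L) ^ n * L)) := by
        rw [lintegral_indicator_norm_pow hn (by positivity) hr hrR,
          ← ENNReal.ofReal_mul hl0.le]
    _ = _ := by
        congr 1
        rw [Real.rpow_sub hL, Real.rpow_one, Real.rpow_natCast, div_pow]
        ring

/-- Passing from the capacity bound to the exponential functional: `exp (-β cap ^ (1 / (1 - n)))`
is at most a power of `r / R`. -/
theorem exp_neg_relCap_ball_le (hn : 2 ≤ n)
    (he : AlmostEuclideanOn e l (Metric.closedBall 0 R))
    (hl : 1 < l) (hΩ : e.symm '' Metric.closedBall 0 R ⊆ Ω) {r : ℝ} (hr : 0 < r) (hrR : r < R)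
    {β : ℝ} (hβ : 0 ≤ β) :
    EReal.exp (-((β : EReal) *
      ((relCap n (n : ℝ≥0∞) (e.symm '' Metric.closedBall 0 r) Ω ^ (1 / (1 - (n : ℝ))) : ℝ≥0∞) :
        EReal))) ≤
    ENNReal.ofReal ((r / R) ^
      (β * (l ^ (2 * n + 1) * (n * unitBallVolume n)) ^ (1 / (1 - (n : ℝ))))) := by
  have hR : 0 < R := hr.trans hrR
  have hν := unitBallVolume_pos n
  have hL : 0 < Real.log (R / r) := Real.log_pos ((one_lt_div hr).2 hrR)
  have hn1 : 1 - (n : ℝ) < 0 := by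
    have : (2 : ℝ) ≤ n := by exact_mod_cast hn
    linarith
  have hn0 : (0 : ℝ) < n := by linarith
  set A := l ^ (2 * n + 1) * (n * unitBallVolume n) with hA
  have hA0 : 0 < A := by positivity
  set L := Real.log (R / r) with hLdef
  have hcap := relCap_conformal_ball_le (by omega) he hl hΩ hr hrR
  rw [← hA, ← hLdef] at hcap
  have hpow : ENNReal.ofReal (A ^ (1 / (1 - (n : ℝ))) * L) ≤
      relCap n (n : ℝ≥0∞) (e.symm '' Metric.closedBall 0 r) Ω ^ (1 / (1 - (n : ℝ))) := by
    refine le_trans (le_of_eq ?_)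
      (rpow_le_rpow_of_nonpos (div_nonpos_of_nonneg_of_nonpos zero_le_one hn1.le) hcap)
    rw [ENNReal.ofReal_rpow_of_pos (by positivity), Real.mul_rpow hA0.le (by positivity),
      ← Real.rpow_mul hL.le, mul_one_div_cancel hn1.ne, Real.rpow_one]
  have hE : ((β * (A ^ (1 / (1 - (n : ℝ))) * L) : ℝ) : EReal) ≤ (β : EReal) *
      ((relCap n (n : ℝ≥0∞) (e.symm '' Metric.closedBall 0 r) Ω ^ (1 / (1 - (n : ℝ))) : ℝ≥0∞) :
        EReal) := by
    rw [EReal.coe_mul]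
    refine mul_le_mul_of_nonneg_left ?_ (by exact_mod_cast hβ)
    have := EReal.coe_ennreal_le_coe_ennreal_iff.2 hpow
    rwa [EReal.coe_ennreal_ofReal, max_eq_left (by positivity)] at this
  refine (EReal.exp_monotone (EReal.neg_le_neg_iff.2 hE)).trans (le_of_eq ?_)
  rw [← EReal.coe_neg, EReal.exp_coe, Real.rpow_def_of_pos (div_pos hr hR),
    show Real.log (r / R) = -L by rw [hLdef, ← Real.log_inv, inv_div]]
  congr 2
  ring

end Balls

/-- The condition on `β` leaves room for a distortion `l > 1` of the metric. -/
theorem exists_distortion {n : ℕ} (hn : 2 ≤ n) {β : ℝ}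
    (hβ : (n : ℝ) ^ ((n : ℝ) / ((n : ℝ) - 1)) * unitBallVolume n ^ (1 / ((n : ℝ) - 1)) < β) :
    ∃ l : ℝ, 1 < l ∧
      (n : ℝ) < β * (l ^ (2 * n + 1) * (n * unitBallVolume n)) ^ (1 / (1 - (n : ℝ))) := by
  have hν := unitBallVolume_pos n
  have hn2 : (2 : ℝ) ≤ n := by exact_mod_cast hn
  have hn0 : (0 : ℝ) < n := by linarith
  have hn1 : 0 < (n : ℝ) - 1 := by linarith
  have hb : 0 < n * unitBallVolume n := by positivity
  have hcont : ContinuousAt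
      (fun l : ℝ ↦ β * (l ^ (2 * n + 1) * (n * unitBallVolume n)) ^ (1 / (1 - (n : ℝ)))) 1 := by
    refine (ContinuousAt.rpow_const ?_ (Or.inl (by simpa using hb.ne'))).const_mul β
    fun_prop
  have h1 : (n : ℝ) <
      β * ((1 : ℝ) ^ (2 * n + 1) * (n * unitBallVolume n)) ^ (1 / (1 - (n : ℝ))) := by
    have hexp : 1 / (1 - (n : ℝ)) = -(1 / ((n : ℝ) - 1)) := by
      rw [← neg_sub, one_div_neg_eq_neg_one_div]
    rw [one_pow, one_mul, hexp, Real.rpow_neg hb.le, ← div_eq_mul_inv, lt_div_iff₀ (by positivity)]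
    refine lt_of_eq_of_lt ?_ hβ
    have hne : (n : ℝ) / ((n : ℝ) - 1) = 1 + 1 / ((n : ℝ) - 1) := by
      field_simp
      ring
    rw [hne, Real.rpow_add hn0, Real.rpow_one, Real.mul_rpow hn0.le hν.le, mul_assoc]
  have hev := (hcont.eventually_const_lt h1).filter_mono (nhdsWithin_le_nhds (s := Ioi 1))
  obtain ⟨l, hl, hl1⟩ := (hev.and self_mem_nhdsWithin).exists
  exact ⟨l, hl1, hl⟩

end RiemCap

theorem theorem1p1 {n : ℕ} (hn : 1 ≤ n)
    {M : Type*} [MetricSpace M] [CompleteSpace M] [MeasurableSpace M] [BorelSpace M]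
    [ChartedSpace (EuclideanSpace ℝ (Fin n)) M] [IsManifold (𝓡 n) ∞ M]
    [RiemannianBundle (fun x : M ↦ TangentSpace (𝓡 n) x)]
    [IsContMDiffRiemannianBundle (𝓡 n) ∞ (EuclideanSpace ℝ (Fin n))
      (fun x : M ↦ TangentSpace (𝓡 n) x)]
    [IsRiemannianManifold (𝓡 n) M]
    {Ω : Set M} (hΩ : IsOpen Ω) (hΩne : Ω.Nonempty) (hΩb : Bornology.IsBounded Ω) :
    (∀ p α : ℝ, 1 ≤ p → p ≠ n → α < 1 - p / n →
      (⨅ K ∈ RiemCap.compactSubsets n Ω,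
        RiemCap.riemannianVolume n M K ^ (-α) * RiemCap.relCap n (ENNReal.ofReal p) K Ω) = 0) ∧
    ((⨅ K ∈ RiemCap.compactSubsets n Ω,
        RiemCap.riemannianVolume n M K ^ (1 / n : ℝ) * RiemCap.relCap n ⊤ K Ω) = 0) ∧
    (2 ≤ n → ∀ β : ℝ,
      (n : ℝ) ^ ((n : ℝ) / ((n : ℝ) - 1)) *
        RiemCap.unitBallVolume n ^ (1 / ((n : ℝ) - 1)) < β →
      (⨅ K ∈ RiemCap.compactSubsets n Ω,
        (RiemCap.riemannianVolume n M K)⁻¹ *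
          EReal.exp (-((β : EReal) *
            ((RiemCap.relCap n (n : ℝ≥0∞) K Ω ^ (1 / (1 - (n : ℝ))) : ℝ≥0∞) : EReal)))) = 0) := by
  have hn0 : (0 : ℝ) < n := by exact_mod_cast hn
  refine ⟨fun p α hp _ hα ↦ ?_, ?_, fun hn2 β hβ ↦ ?_⟩
  · obtain ⟨e, R, hR, he, heΩ⟩ := RiemCap.exists_almostEuclideanOn (n := n) hΩ hΩne one_lt_two
    obtain ⟨c, hc, hvol⟩ := RiemCap.exists_riemannianVolume_ball_rpow_le he one_lt_two α
    obtain ⟨d, hd, hcap⟩ := RiemCap.exists_relCap_ball_le he one_lt_two heΩ (p := p) (by linarith)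
    have hγ : 0 < (n : ℝ) - p - n * α := by
      have h1 := mul_lt_mul_of_pos_left hα hn0
      rw [mul_sub, mul_one, mul_div_cancel₀ _ hn0.ne'] at h1
      linarith
    refine RiemCap.iInf_eq_zero_of_le_rpow (c := c ^ (-α) * d) hγ (half_pos hR) fun r hr hrR ↦
      ⟨_, RiemCap.ball_mem_compactSubsets he one_lt_two heΩ hr (by linarith), ?_⟩
    refine (mul_le_mul' (hvol r hr (by linarith)) (hcap r hr (by linarith))).trans (le_of_eq ?_)
    rw [← ENNReal.ofReal_mul (by positivity), Real.mul_rpow hc.le (by positivity),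
      ← Real.rpow_natCast r n, ← Real.rpow_mul hr.le,
      show (n : ℝ) - p - n * α = n * (-α) + (n - p) by ring, Real.rpow_add hr]
    congr 1
    ring
  · obtain ⟨e, R, hR, he, heΩ⟩ := RiemCap.exists_almostEuclideanOn (n := n) hΩ hΩne one_lt_two
    obtain ⟨d, hd, hcap⟩ := RiemCap.relCap_top_ball_le he hR one_lt_two heΩ
    have hν := RiemCap.unitBallVolume_pos n
    -- a single test function serves all small balls, so only the volume has to tend to zero
    refine RiemCap.iInf_eq_zero_of_le_rpow
      (c := (2 * RiemCap.unitBallVolume n) ^ (1 / n : ℝ) * d) one_pos (half_pos hR) fun r hr hrR ↦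
      ⟨_, RiemCap.ball_mem_compactSubsets he one_lt_two heΩ hr (by linarith), ?_⟩
    refine (mul_le_mul' (ENNReal.rpow_le_rpow
      (RiemCap.riemannianVolume_ball_le he one_lt_two hr (by linarith)) (by positivity))
      (hcap r hr hrR.le)).trans (le_of_eq ?_)
    rw [ENNReal.ofReal_rpow_of_pos (by positivity), ← ENNReal.ofReal_mul (by positivity),
      Real.mul_rpow (by positivity) (by positivity), ← Real.rpow_natCast r n,
      ← Real.rpow_mul hr.le, mul_one_div_cancel hn0.ne']
    congr 1
    ring
  · obtain ⟨l, hl, hlβ⟩ := RiemCap.exists_distortion hn2 hβ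
    obtain ⟨e, R, hR, he, heΩ⟩ := RiemCap.exists_almostEuclideanOn (n := n) hΩ hΩne hl
    have hν := RiemCap.unitBallVolume_pos n
    have hβ0 : 0 ≤ β := le_trans (by positivity) hβ.le
    set γ := β * (l ^ (2 * n + 1) * (n * RiemCap.unitBallVolume n)) ^ (1 / (1 - (n : ℝ))) with hγ
    refine RiemCap.iInf_eq_zero_of_le_rpow
      (c := (l⁻¹ * RiemCap.unitBallVolume n)⁻¹ * (R ^ γ)⁻¹) (sub_pos.2 hlβ) hR fun r hr hrR ↦
      ⟨_, RiemCap.ball_mem_compactSubsets he hl heΩ hr hrR.le, ?_⟩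
    refine (mul_le_mul' (ENNReal.inv_le_inv.2 (RiemCap.le_riemannianVolume_ball he hl hr hrR.le))
      (RiemCap.exp_neg_relCap_ball_le hn2 he hl heΩ hr hrR hβ0)).trans (le_of_eq ?_)
    rw [← ENNReal.ofReal_inv_of_pos (by positivity), ← ENNReal.ofReal_mul (by positivity), ← hγ,
      Real.div_rpow hr.le hR.le, Real.rpow_sub hr, Real.rpow_natCast]
    congr 1
    field_simp
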